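/- Let $G$ be a countable amenable group acting by homeomorphisms $T^g$ on a compact metric space $(X,d)$. Let $(F_n)$ be any Følner sequence of $G$: nonempty finite subsets with $|KF_n\,\triangle\,F_n|/|F_n|\to0$ for every nonempty finite $K\subset G$. For an open cover $\mathcal U$ of $X$ put $$h_{\mathrm{top}}(T,\mathcal U)=\lim_{n\to\infty}\frac1{|F_n|}\log N\Big(\bigvee_{g\in F_n}T^{g^{-1}}\mathcal U\Big),$$ where $N$ is the minimal cardinality of a subcover (the limit exists and does not depend on the Følner sequence). Let $\Delta\subset X^2$ be the diagonal and define: - $\mathtt E(X,T)$, the set of entropy pairs: pairs $(x,y)$ with $x\ne y$ such that $h_{\mathrm{top}}(T,\{U_x^{c},U_y^{c}\})>0$ for all disjoint closed neighborhoods $U_x$ of $x$ and $U_y$ of $y$; - $\mathtt A^{\varepsilon}(X,T)$, the set of pairs $(x,y)$ with $d(T^gx,T^gy)\le\varepsilon$ for all $g$ outside some finite subset of $G$, and $\mathtt A(X,T)=\bigcap_{\varepsilon>0}\mathtt A^{\varepsilon}(X,T)$. Assume that $(X,T)$ has the pseudo-orbit tracing property: for every $\varepsilon>0$ there are $\delta>0$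 and a finite $S\subset G$ such that for every family $(x_g)_{g\in G}$ in $X$ with $d(T^sx_g,x_{sg})<\delta$ for all $s\in S$, $g\in G$, there is $z\in X$ with $d(T^gz,x_g)\le\varepsilon$ for all $g\in G$. Then: (i) If $(x,y)\in\mathtt E(X,T)$, then $(x,y)\in\overline{\mathtt A^{\varepsilon}(X,T)}\setminus\Delta$ for every $\varepsilon>0$, and there is a $G$-invariant Borel probability measure $\mu$ on $X$ with $x,y\in\operatorname{supp}(\mu)$. (ii) If $(x,y)\in\mathtt A(X,T)$ and there is a $G$-invariant Borel probability measure $\mu$ on $X$ with $x,y\in\operatorname{supp}(\mu)$, then $(x,y)\in\mathtt E(X,T)\cup\Delta$. -/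

import Mathlib

/-! Actions `G ↷ X` by homeomorphisms on a compact metric space are encoded by
`[MulAction G X] [ContinuousConstSMul G X]`; `g • x` is `T^g x`. -/

namespace GTDS

open Filter Topology MeasureTheory

section Folner

variable {G : Type*} [Group G]

open scoped Classical Pointwise symmDiff in
/-- A (left) Følner sequence: nonempty finite sets `F n ⊆ G` such that
`|K F_n ∆ F_n| / |F_n| → 0` for every nonempty finite `K ⊆ G`. (For `K = ∅` the quotient is
constantly `1`.) A countable group is amenable iff it has such a sequence. -/
structure IsFolner (F : ℕ → Finset G) : Prop where
  nonempty : ∀ n, (F n).Nonempty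
  tendsto : ∀ K : Finset G, K.Nonempty →
    Tendsto (fun n => (((K * F n) ∆ F n).card : ℝ) / ((F n).card : ℝ)) atTop (𝓝 0)

end Folner

section Cover

variable {X : Type*}

/-- `N(𝒰)`: the minimum cardinality of a (finite) subcover of `𝒰`. -/
noncomputable def minSubcover (𝒰 : Set (Set X)) : ℕ :=
  sInf {n : ℕ | ∃ 𝒱 : Finset (Set X),
    (𝒱 : Set (Set X)) ⊆ 𝒰 ∧ ⋃₀ (𝒱 : Set (Set X)) = Set.univ ∧ 𝒱.card = n}

variable {G : Type*} [Group G] [MulAction G X]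

/-- `𝒰^F = ⋁_{g ∈ F} T^{g⁻¹} 𝒰`: the sets `⋂_{g ∈ F} T^{g⁻¹} (A g)` with all `A g ∈ 𝒰`. -/
def refineCover (𝒰 : Set (Set X)) (F : Finset G) : Set (Set X) :=
  {V | ∃ A : G → Set X, (∀ g ∈ F, A g ∈ 𝒰) ∧ V = ⋂ g ∈ F, (fun x : X => g • x) ⁻¹' (A g)}

/-- The topological entropy of the action with respect to the open cover `𝒰`, computed along `F`:
`lim_n (1 / |F_n|) log N(𝒰^{F_n})`. For a Følner sequence `F` (and `X` compact) the limit is known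
to exist and not to depend on `F`; it is written as a `limsup` in the extended reals, which agrees
with the limit whenever the latter exists. -/
noncomputable def coverEntropy (F : ℕ → Finset G) (𝒰 : Set (Set X)) : EReal :=
  limsup (fun n =>
    ((Real.log (minSubcover (refineCover 𝒰 (F n)) : ℝ) / ((F n).card : ℝ) : ℝ) : EReal)) atTop

/-- `E(X,T)`: the entropy pairs, with entropy computed along the Følner sequence `F`. -/
def entropyPairs [TopologicalSpace X] (F : ℕ → Finset G) : Set (X × X) :=
  {p | p.1 ≠ p.2 ∧ ∀ U V : Set X, IsClosed U → IsClosed V → U ∈ 𝓝 p.1 → V ∈ 𝓝 p.2 →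
    Disjoint U V → 0 < coverEntropy F {Uᶜ, Vᶜ}}

end Cover

section Metric

variable (G X : Type*) [Group G] [MetricSpace X] [MulAction G X]

/-- `A^ε(X,T)`: pairs with `d(T^g x, T^g y) ≤ ε` for all `g` outside some finite set. -/
def epsAsymptoticPairs (ε : ℝ) : Set (X × X) :=
  {p | ∃ F : Finset G, ∀ g, g ∉ F → dist (g • p.1) (g • p.2) ≤ ε}

/-- `A(X,T)`: the asymptotic pairs. -/
def asymptoticPairs : Set (X × X) :=
  {p | ∀ ε : ℝ, 0 < ε → p ∈ epsAsymptoticPairs G X ε}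

variable {G X}

/-- `(x_g)` is an `(S, δ)` pseudo-orbit. -/
def IsPseudoOrbit (S : Finset G) (δ : ℝ) (x : G → X) : Prop :=
  ∀ s ∈ S, ∀ g : G, dist (s • x g) (x (s * g)) < δ

/-- The pseudo-orbit `(x_g)` is `ε`-traced by `z`. -/
def IsTracedBy (ε : ℝ) (x : G → X) (z : X) : Prop :=
  ∀ g : G, dist (g • z) (x g) ≤ ε

variable (G X)

/-- The pseudo-orbit tracing property. -/
def HasPOTP : Prop :=
  ∀ ε : ℝ, 0 < ε → ∃ δ : ℝ, 0 < δ ∧ ∃ S : Finset G,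
    ∀ x : G → X, IsPseudoOrbit S δ x → ∃ z : X, IsTracedBy ε x z

variable {X}

/-- Both `x` and `y` lie in the support of a common `G`-invariant Borel probability measure. -/
def InCommonSupport [MeasurableSpace X] (x y : X) : Prop :=
  ∃ μ : Measure X, IsProbabilityMeasure μ ∧ SMulInvariantMeasure G X μ ∧
    x ∈ μ.support ∧ y ∈ μ.support

end Metric

end GTDS

/-! Both directions go through independence sets: finite `J ⊆ G` such that every choice, for each
`g ∈ J`, between `g • z ∈ U` and `g • z ∈ V` is realised by some point `z`.

Positive entropy of `{Uᶜ, Vᶜ}` yields independence sets of positive density in infinitely many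
Følner sets (`exists_independence_density`). This is combinatorial: a member of the refined cover is
a binary word, and `exists_coveredBy_card_le` bounds the number of words needed in terms of the
number of independence sets, by predicting the itinerary of a point one index at a time so that
every wrong prediction halves the number of independence sets that remain.

For an entropy pair `(x, y)` with small neighbourhoods `U`, `V`, pigeonhole on the boundary of a
Følner set gives two points with different itineraries inside and nearly equal orbits along the
boundary; glueing the two orbits there and tracing gives an `ε`-asymptotic pair near `(x, y)`
(`exists_mem_epsAsymptoticPairs`). A point choosing `U` throughout the independence set has
empirical measures with a weak limit that charges `U`, and likewise for `V`
(`exists_invariant_measure_pos`); a convex combination over shrinking neighbourhoods has both `x`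
and `y` in its support.

Conversely, if an invariant measure has `x` in its support, some orbit segment over each `F n`
returns near `x` with a uniform density (`exists_orbit_density`). When `(x, y)` is asymptotic, any
selection of sufficiently separated passages near `x` can be replaced by passages of `y`, giving
pseudo-orbits whose tracing points show that the return times are independent
(`exists_isIndependent_of_asymptotic`). Hence the refined covers grow exponentially. -/

namespace GTDS

open Filter Topology MeasureTheory

/-! ### Independence sets and covers by words -/

section Independence

variable {ι X : Type*}

/-- `J` is an independence set for the family of pairs `(A i false, A i true)` inside `Y`: every
choice of one set from each pair with index in `J` is realised by a point of `Y`. -/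
def IsIndependent (A : ι → Bool → Set X) (Y : Set X) (J : Finset ι) : Prop :=
  ∀ σ : ι → Bool, ∃ y ∈ Y, ∀ i ∈ J, y ∈ A i (σ i)

lemma IsIndependent.mono {A : ι → Bool → Set X} {Y Z : Set X} {J : Finset ι}
    (h : IsIndependent A Y J) (hYZ : Y ⊆ Z) : IsIndependent A Z J := fun σ => by
  obtain ⟨y, hy, hyJ⟩ := h σ
  exact ⟨y, hYZ hy, hyJ⟩

open scoped Classical in
/-- The independence sets contained in a given finite index set `F`. -/
noncomputable def independentSubsets (A : ι → Bool → Set X) (Y : Set X) (F : Finset ι) :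
    Finset (Finset ι) :=
  F.powerset.filter (IsIndependent A Y)

lemma mem_independentSubsets {A : ι → Bool → Set X} {Y : Set X} {F J : Finset ι} :
    J ∈ independentSubsets A Y F ↔ J ⊆ F ∧ IsIndependent A Y J := by
  simp [independentSubsets]

lemma independentSubsets_mono (A : ι → Bool → Set X) {Y Z : Set X} {E F : Finset ι}
    (hYZ : Y ⊆ Z) (hEF : E ⊆ F) : independentSubsets A Y E ⊆ independentSubsets A Z F := by
  intro J hJ
  rw [mem_independentSubsets] at hJ ⊢
  exact ⟨hJ.1.trans hEF, hJ.2.mono hYZ⟩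

/-- A set which is independent in both halves `Y ∩ A i b` yields two independent sets in `Y`,
one with `i` and one without. -/
lemma card_independentSubsets_add_le [DecidableEq ι] (A : ι → Bool → Set X) (Y : Set X)
    {F : Finset ι} {i : ι} (hi : i ∉ F) :
    (independentSubsets A (Y ∩ A i true) F).card + (independentSubsets A (Y ∩ A i false) F).card
      ≤ (independentSubsets A Y (insert i F)).card := by
  classical
  set P := independentSubsets A (Y ∩ A i true) F
  set Q := independentSubsets A (Y ∩ A i false) F
  have hnot : ∀ J ∈ P ∪ Q, i ∉ J := by
    intro J hJ hiJ
    rcases Finset.mem_union.1 hJ with h | h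
    · exact hi ((mem_independentSubsets.1 h).1 hiJ)
    · exact hi ((mem_independentSubsets.1 h).1 hiJ)
  have hinj : Set.InjOn (insert i) ((P ∩ Q : Finset (Finset ι)) : Set (Finset ι)) := by
    intro J hJ J' hJ' h
    have h1 := hnot J (Finset.mem_union_left _ (Finset.mem_inter.1 hJ).1)
    have h2 := hnot J' (Finset.mem_union_left _ (Finset.mem_inter.1 hJ').1)
    rw [← Finset.erase_insert h1, ← Finset.erase_insert h2]
    exact congrArg (fun s => Finset.erase s i) h
  have hdisj : Disjoint (P ∪ Q) ((P ∩ Q).image (insert i)) := by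
    rw [Finset.disjoint_left]
    intro J hJ hJ'
    obtain ⟨J₀, -, rfl⟩ := Finset.mem_image.1 hJ'
    exact hnot _ hJ (Finset.mem_insert_self _ _)
  rw [← Finset.card_union_add_card_inter, ← Finset.card_image_of_injOn hinj,
    ← Finset.card_union_of_disjoint hdisj]
  apply Finset.card_le_card
  apply Finset.union_subset
  · apply Finset.union_subset
    · exact independentSubsets_mono A Set.inter_subset_left (Finset.subset_insert _ _)
    · exact independentSubsets_mono A Set.inter_subset_left (Finset.subset_insert _ _)
  · intro J hJ
    obtain ⟨J, hJ₀, rfl⟩ := Finset.mem_image.1 hJ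
    obtain ⟨hP, hQ⟩ := Finset.mem_inter.1 hJ₀
    rw [mem_independentSubsets] at hP hQ ⊢
    refine ⟨Finset.insert_subset_insert _ hP.1, fun σ => ?_⟩
    rcases hb : σ i with _ | _
    · obtain ⟨y, hy, hyJ⟩ := hQ.2 σ
      exact ⟨y, hy.1, Finset.forall_mem_insert _ _ _ |>.2 ⟨by rw [hb]; exact hy.2, hyJ⟩⟩
    · obtain ⟨y, hy, hyJ⟩ := hP.2 σ
      exact ⟨y, hy.1, Finset.forall_mem_insert _ _ _ |>.2 ⟨by rw [hb]; exact hy.2, hyJ⟩⟩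

/-- A finite set of words covers `Y` if every point of `Y` avoids all the sets `A i (τ i)`,
`i ∈ F`, for one of the words `τ`. -/
def CoveredBy (A : ι → Bool → Set X) (Y : Set X) (F : Finset ι) (W : Finset (ι → Bool)) : Prop :=
  ∀ y ∈ Y, ∃ τ ∈ W, ∀ i ∈ F, y ∉ A i (τ i)

/-- Few independence sets force a small cover. At an index `i` one of the two halves `Y ∩ A i b`
has at most half of the independence sets; its points are the ones on which the word taking the
value `b` at `i` fails, and splitting them off halves the number of independence sets. -/
lemma exists_coveredBy_card_le (A : ι → Bool → Set X)
    (hA : ∀ i b, Disjoint (A i b) (A i (!b))) {t : ℝ} (ht : 0 ≤ t) (F : Finset ι) (Y : Set X) :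
    ∃ W : Finset (ι → Bool), CoveredBy A Y F W ∧
      (W.card : ℝ) ≤ ((independentSubsets A Y F).card : ℝ) ^ t * (1 + 2 ^ (-t)) ^ F.card := by
  classical
  induction F using Finset.induction_on generalizing Y with
  | empty =>
    rcases Y.eq_empty_or_nonempty with rfl | ⟨y, hy⟩
    · refine ⟨∅, fun y hy => hy.elim, ?_⟩
      simp only [Finset.card_empty, Nat.cast_zero, pow_zero, mul_one]
      positivity
    · refine ⟨{fun _ => true}, fun y _ => ⟨_, Finset.mem_singleton_self _, by simp⟩, ?_⟩
      have h1 : (1 : ℝ) ≤ (independentSubsets A Y ∅).card := by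
        have : 0 < (independentSubsets A Y ∅).card := by
          rw [Finset.card_pos]
          exact ⟨∅, mem_independentSubsets.2 ⟨subset_rfl, fun σ => ⟨y, hy, by simp⟩⟩⟩
        exact_mod_cast this
      simpa using Real.one_le_rpow h1 ht
  | insert i F hi ih =>
    set N := independentSubsets A Y (insert i F) with hN
    obtain ⟨b, hb⟩ : ∃ b : Bool, 2 * (independentSubsets A (Y ∩ A i b) F).card ≤ N.card := by
      have := card_independentSubsets_add_le A Y hi
      rw [← hN] at this
      rcases le_total (independentSubsets A (Y ∩ A i true) F).card
        (independentSubsets A (Y ∩ A i false) F).card with h | h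
      · exact ⟨true, by omega⟩
      · exact ⟨false, by omega⟩
    obtain ⟨W₁, hW₁, hc₁⟩ := ih (Y \ A i b)
    obtain ⟨W₂, hW₂, hc₂⟩ := ih (Y ∩ A i b)
    have hup : ∀ (τ : ι → Bool) (a : Bool), ∀ j ∈ F, Function.update τ i a j = τ j := by
      intro τ a j hj
      rw [Function.update_of_ne]
      rintro rfl
      exact hi hj
    refine ⟨W₁.image (fun τ => Function.update τ i b) ∪
      W₂.image (fun τ => Function.update τ i (!b)), ?_, ?_⟩
    · intro y hy
      by_cases hyb : y ∈ A i b
      · obtain ⟨τ, hτ, h⟩ := hW₂ y ⟨hy, hyb⟩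
        refine ⟨_, Finset.mem_union_right _ (Finset.mem_image_of_mem _ hτ), ?_⟩
        rw [Finset.forall_mem_insert]
        refine ⟨?_, fun j hj => by rw [hup _ _ j hj]; exact h j hj⟩
        rw [Function.update_self]
        exact Set.disjoint_left.1 (hA i b) hyb
      · obtain ⟨τ, hτ, h⟩ := hW₁ y ⟨hy, hyb⟩
        refine ⟨_, Finset.mem_union_left _ (Finset.mem_image_of_mem _ hτ), ?_⟩
        rw [Finset.forall_mem_insert]
        refine ⟨?_, fun j hj => by rw [hup _ _ j hj]; exact h j hj⟩
        rwa [Function.update_self]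
    · have hle₁ : ((independentSubsets A (Y \ A i b) F).card : ℝ) ≤ N.card := by
        exact_mod_cast Finset.card_le_card
          (independentSubsets_mono A Set.sdiff_subset (Finset.subset_insert _ _))
      have hle₂ : ((independentSubsets A (Y ∩ A i b) F).card : ℝ) ≤ N.card * 2⁻¹ := by
        have : (2 : ℝ) * (independentSubsets A (Y ∩ A i b) F).card ≤ N.card := by exact_mod_cast hb
        linarith
      have hcard : (((W₁.image (fun τ => Function.update τ i b) ∪
          W₂.image (fun τ => Function.update τ i (!b))).card : ℕ) : ℝ) ≤ W₁.card + W₂.card := by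
        exact_mod_cast (Finset.card_union_le _ _).trans
          (add_le_add Finset.card_image_le Finset.card_image_le)
      have h₁ := hc₁.trans (mul_le_mul_of_nonneg_right
        (Real.rpow_le_rpow (by positivity) hle₁ ht) (by positivity))
      have h₂ := hc₂.trans (mul_le_mul_of_nonneg_right
        (Real.rpow_le_rpow (by positivity) hle₂ ht) (by positivity))
      rw [Real.mul_rpow (by positivity) (by positivity), Real.inv_rpow (by positivity),
        ← Real.rpow_neg (by positivity)] at h₂
      rw [Finset.card_insert_of_notMem hi, pow_succ]
      calc _ ≤ _ := hcard
        _ ≤ _ := add_le_add h₁ h₂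
        _ = _ := by ring

/-- The number of subsets of `F` with at most `d` elements is at most
`q ^ (-d) * (1 + q) ^ |F|` for every `0 < q ≤ 1`; with `q = exp (-M)` this bounds the number of
independence sets when all of them are that small. -/
lemma card_independentSubsets_le (A : ι → Bool → Set X) (Y : Set X) (F : Finset ι) {d M : ℝ}
    (hM : 0 ≤ M) (h : ∀ J ⊆ F, IsIndependent A Y J → (J.card : ℝ) ≤ d) :
    ((independentSubsets A Y F).card : ℝ) ≤ Real.exp (M * d + Real.exp (-M) * F.card) := by
  classical
  have hbinom : ∑ J ∈ F.powerset, Real.exp (-M) ^ J.card = (1 + Real.exp (-M)) ^ F.card := by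
    simpa [add_comm] using Finset.sum_pow_mul_eq_add_pow (Real.exp (-M)) 1 F
  have hone : ∀ J ∈ independentSubsets A Y F, 1 ≤ Real.exp (M * d) * Real.exp (-M) ^ J.card := by
    intro J hJ
    obtain ⟨hJF, hJ⟩ := mem_independentSubsets.1 hJ
    rw [← Real.exp_nat_mul, ← Real.exp_add, Real.one_le_exp_iff]
    nlinarith [h J hJF hJ]
  calc ((independentSubsets A Y F).card : ℝ)
      = ∑ J ∈ independentSubsets A Y F, 1 := by simp
    _ ≤ ∑ J ∈ independentSubsets A Y F, Real.exp (M * d) * Real.exp (-M) ^ J.card :=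
        Finset.sum_le_sum hone
    _ ≤ ∑ J ∈ F.powerset, Real.exp (M * d) * Real.exp (-M) ^ J.card :=
        Finset.sum_le_sum_of_subset_of_nonneg
          (fun J hJ => Finset.mem_powerset.2 (mem_independentSubsets.1 hJ).1)
          fun _ _ _ => by positivity
    _ = Real.exp (M * d) * (1 + Real.exp (-M)) ^ F.card := by rw [← Finset.mul_sum, hbinom]
    _ ≤ Real.exp (M * d) * Real.exp (Real.exp (-M)) ^ F.card := by
        gcongr
        linarith [Real.add_one_le_exp (Real.exp (-M))]
    _ = _ := by rw [← Real.exp_nat_mul, ← Real.exp_add, mul_comm (F.card : ℝ)]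

/-- If covering `X` takes exponentially many words, then there is an independence set of
proportional size, with a proportion that depends on the exponential rate only. -/
theorem exists_density_of_large_cover {a : ℝ} (ha : 0 < a) :
    ∃ c : ℝ, 0 < c ∧ ∀ {ι X : Type*} (A : ι → Bool → Set X),
      (∀ i b, Disjoint (A i b) (A i (!b))) → ∀ F : Finset ι,
      (∀ W, CoveredBy A Set.univ F W → Real.exp (a * F.card) < W.card) →
      ∃ J ⊆ F, IsIndependent A Set.univ J ∧ c * F.card < J.card := by
  -- The cover has at most `exp ((t * (M * c + exp (-M)) + 2 ^ (-t)) * |F|)` words; each of the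
  -- three terms of the exponent is made at most `a / 3`.
  obtain ⟨t, ht2, ht⟩ : ∃ t : ℝ, (2 : ℝ) ^ (-t) < a / 3 ∧ 0 < t := by
    have h : Tendsto (fun t : ℝ => (2 : ℝ) ^ (-t)) atTop (𝓝 0) := by
      have := (tendsto_rpow_atTop_of_base_lt_one (2⁻¹ : ℝ) (by norm_num) (by norm_num))
      refine this.congr fun t => ?_
      rw [Real.inv_rpow (by norm_num), Real.rpow_neg (by norm_num)]
    exact ((h.eventually_lt_const (by positivity)).and (eventually_gt_atTop 0)).exists
  obtain ⟨M, hM2, hM⟩ : ∃ M : ℝ, Real.exp (-M) < a / (3 * t) ∧ 0 < M :=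
    ((Real.tendsto_exp_neg_atTop_nhds_zero.eventually_lt_const (by positivity)).and
      (eventually_gt_atTop 0)).exists
  refine ⟨a / (3 * t * M), by positivity, fun {ι X} A hA F hW => ?_⟩
  by_contra! hcon
  obtain ⟨W, hWc, hWle⟩ := exists_coveredBy_card_le A hA ht.le F Set.univ
  have hind := card_independentSubsets_le A Set.univ F hM.le hcon
  refine absurd (hW W hWc) (not_lt.2 (hWle.trans ?_))
  calc ((independentSubsets A Set.univ F).card : ℝ) ^ t * (1 + 2 ^ (-t)) ^ F.card
      ≤ (Real.exp (M * (a / (3 * t * M) * F.card) + Real.exp (-M) * F.card)) ^ t *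
          Real.exp (a / 3) ^ F.card := by
        gcongr
        linarith [Real.add_one_le_exp (a / 3)]
    _ = Real.exp ((a / 3 + Real.exp (-M) * t + a / 3) * F.card) := by
        rw [← Real.exp_mul, ← Real.exp_nat_mul, ← Real.exp_add]
        congr 1
        field_simp
    _ ≤ Real.exp (a * F.card) := by
        have : Real.exp (-M) * t ≤ a / 3 := by
          have := mul_le_mul_of_nonneg_right hM2.le ht.le
          calc _ ≤ _ := this
            _ = a / 3 := by field_simp
        gcongr
        linarith

end Independence

/-! ### Independence density from positive entropy -/

section EntropyIndependence

variable {G X : Type*} [Group G] [MulAction G X]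

/-- The pairs of translates `(g⁻¹ V, g⁻¹ U)`, with `U` labelled by `true`. -/
def translates (G : Type*) [Group G] [MulAction G X] (U V : Set X) : G → Bool → Set X :=
  fun g b => (fun x : X => g • x) ⁻¹' (bif b then U else V)

lemma disjoint_translates {U V : Set X} (h : Disjoint U V) (g : G) (b : Bool) :
    Disjoint (translates G U V g b) (translates G U V g (!b)) := by
  cases b
  · exact h.symm.preimage _
  · exact h.preimage _

lemma exists_subcover_of_coveredBy {U V : Set X} {F : Finset G} {W : Finset (G → Bool)}
    (hW : CoveredBy (translates G U V) Set.univ F W) :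
    ∃ 𝒱 : Finset (Set X), (𝒱 : Set (Set X)) ⊆ refineCover {Uᶜ, Vᶜ} F ∧
      ⋃₀ (𝒱 : Set (Set X)) = Set.univ ∧ 𝒱.card ≤ W.card := by
  classical
  refine ⟨W.image fun τ => ⋂ g ∈ F, (fun x : X => g • x) ⁻¹' (bif τ g then U else V)ᶜ,
    ?_, ?_, Finset.card_image_le⟩
  · intro S hS
    obtain ⟨τ, -, rfl⟩ := Finset.mem_image.1 (Finset.mem_coe.1 hS)
    refine ⟨fun g => (bif τ g then U else V)ᶜ, fun g _ => ?_, rfl⟩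
    cases h : τ g <;> simp [h]
  · refine Set.eq_univ_of_forall fun x => ?_
    obtain ⟨τ, hτ, h⟩ := hW x trivial
    refine ⟨_, Finset.mem_coe.2 (Finset.mem_image_of_mem _ hτ), ?_⟩
    rw [Set.mem_iInter₂]
    exact h

lemma minSubcover_le_card {U V : Set X} {F : Finset G} {W : Finset (G → Bool)}
    (hW : CoveredBy (translates G U V) Set.univ F W) :
    minSubcover (refineCover {Uᶜ, Vᶜ} F) ≤ W.card := by
  obtain ⟨𝒱, h1, h2, h3⟩ := exists_subcover_of_coveredBy hW
  have hmem : minSubcover (refineCover {Uᶜ, Vᶜ} F) ≤ 𝒱.card := Nat.sInf_le ⟨𝒱, h1, h2, rfl⟩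
  exact hmem.trans h3

/-- Points realising different choices on an independence set lie in different members of the
refined cover. -/
lemma two_pow_le_minSubcover {U V : Set X} (hUV : Disjoint U V) {F J : Finset G} (hJF : J ⊆ F)
    (hJ : IsIndependent (translates G U V) Set.univ J) :
    2 ^ J.card ≤ minSubcover (refineCover {Uᶜ, Vᶜ} F) := by
  classical
  have hne : {n : ℕ | ∃ 𝒱 : Finset (Set X), (𝒱 : Set (Set X)) ⊆ refineCover {Uᶜ, Vᶜ} F ∧
      ⋃₀ (𝒱 : Set (Set X)) = Set.univ ∧ 𝒱.card = n}.Nonempty := by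
    obtain ⟨W, hW, -⟩ := exists_coveredBy_card_le (translates G U V)
      (disjoint_translates hUV) zero_le_one F Set.univ
    obtain ⟨𝒱, h1, h2, -⟩ := exists_subcover_of_coveredBy hW
    exact ⟨_, 𝒱, h1, h2, rfl⟩
  obtain ⟨𝒱, hsub, hcov, hcard⟩ := Nat.sInf_mem hne
  rw [minSubcover, ← hcard]
  have hpt : ∀ σ : J → Bool, ∃ S : {S // S ∈ 𝒱}, ∃ x ∈ (S : Set X),
      ∀ g : J, x ∈ translates G U V (g : G) (σ g) := by
    intro σ
    obtain ⟨x, -, hx⟩ := hJ fun g => if hg : g ∈ J then σ ⟨g, hg⟩ else true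
    obtain ⟨S, hS, hxS⟩ : x ∈ ⋃₀ (𝒱 : Set (Set X)) := hcov ▸ Set.mem_univ x
    exact ⟨⟨S, hS⟩, x, hxS, fun g => by simpa using hx g g.2⟩
  choose S x hxS hx using hpt
  have hinj : Function.Injective S := by
    intro σ σ' h
    funext g
    by_contra hne
    obtain ⟨B, hB, hS⟩ := hsub (S σ).2
    have h1 : (g : G) • x σ ∈ B g := by
      have := hxS σ
      rw [hS, Set.mem_iInter₂] at this
      exact this g (hJF g.2)
    have h2 : (g : G) • x σ' ∈ B g := by
      have := hxS σ'
      rw [← h, hS, Set.mem_iInter₂] at this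
      exact this g (hJF g.2)
    have h3 := hx σ g
    have h4 := hx σ' g
    simp only [translates, Set.mem_preimage] at h3 h4
    rcases hB g (hJF g.2) with hBg | hBg <;> rw [hBg] at h1 h2 <;>
      cases hs : σ g <;> cases hs' : σ' g <;> simp_all
  simpa using Fintype.card_le_of_injective S hinj

/-- Positive entropy of `{Uᶜ, Vᶜ}` gives independence sets of positive density in infinitely many
of the sets `F n`. -/
theorem exists_independence_density {U V : Set X} (hUV : Disjoint U V) {F : ℕ → Finset G}
    (hF : ∀ n, (F n).Nonempty) (h : 0 < coverEntropy F {Uᶜ, Vᶜ}) :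
    ∃ c : ℝ, 0 < c ∧ ∃ᶠ n in atTop, ∃ J ⊆ F n,
      IsIndependent (translates G U V) Set.univ J ∧ c * (F n).card < J.card := by
  obtain ⟨a, ha0, ha⟩ := EReal.lt_iff_exists_real_btwn.1 h
  have ha0 : 0 < a := by exact_mod_cast ha0
  obtain ⟨c, hc, hcJ⟩ := exists_density_of_large_cover ha0
  refine ⟨c, hc, (frequently_lt_of_lt_limsup (by isBoundedDefault) ha).mono fun n hn => ?_⟩
  refine hcJ _ (disjoint_translates hUV) (F n) fun W hW => ?_
  have hpos : (0 : ℝ) < (F n).card := by exact_mod_cast (hF n).card_pos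
  rw [EReal.coe_lt_coe_iff, lt_div_iff₀ hpos] at hn
  have hN : (0 : ℝ) < minSubcover (refineCover {Uᶜ, Vᶜ} (F n)) := by
    rcases Nat.eq_zero_or_pos (minSubcover (refineCover {Uᶜ, Vᶜ} (F n))) with h0 | h0
    · rw [h0] at hn
      simp only [Nat.cast_zero, Real.log_zero] at hn
      exact absurd hn (not_lt.2 (by positivity))
    · exact_mod_cast h0
  calc _ < _ := (Real.lt_log_iff_exp_lt hN).1 hn
    _ ≤ _ := by exact_mod_cast minSubcover_le_card hW

end EntropyIndependence

/-! ### Boundaries of Følner sets -/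

section Boundary

variable {G : Type*} [Group G]

open scoped Classical Pointwise symmDiff in
/-- The points reached from a point `g` by a left translation `g ↦ s * g`, `s ∈ S`, which enters or
leaves `F`. -/
noncomputable def crossing (S F : Finset G) : Finset G :=
  S.biUnion fun s => ({s} * F) ∆ F

lemma mem_crossing {S F : Finset G} {s g : G} (hs : s ∈ S) (h : ¬ (g ∈ F ↔ s * g ∈ F)) :
    s * g ∈ crossing S F := by
  simp only [crossing, Finset.mem_biUnion, Finset.mem_symmDiff, Finset.singleton_mul]
  refine ⟨s, hs, ?_⟩
  simp only [smul_eq_mul, Finset.mem_smul_finset, mul_right_inj, exists_eq_right]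
  tauto

lemma IsFolner.tendsto_crossing {F : ℕ → Finset G} (hF : IsFolner F) (S : Finset G) :
    Tendsto (fun n => ((crossing S (F n)).card : ℝ) / (F n).card) atTop (𝓝 0) := by
  classical
  have hsum := tendsto_finsetSum S fun s _ => hF.tendsto {s} (Finset.singleton_nonempty s)
  simp only [Finset.sum_const_zero] at hsum
  refine squeeze_zero (fun n => by positivity) (fun n => ?_) hsum
  rw [← Finset.sum_div]
  gcongr
  exact_mod_cast Finset.card_biUnion_le

end Boundary

/-! ### Asymptotic pairs from independence -/

section Tracing

variable {G X : Type*} [Group G] [MetricSpace X] [CompactSpace X] [MulAction G X]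

/-- In a system with the pseudo-orbit tracing property, independence sets of positive density
produce `ε`-asymptotic pairs. The boundary of a Følner set is so small that two points with
different itineraries have almost the same orbit there; the pseudo-orbit which follows one of them
inside the Følner set and the other one outside is then traced. -/
theorem exists_mem_epsAsymptoticPairs {F : ℕ → Finset G} (hF : IsFolner F) (hT : HasPOTP G X)
    {U V : Set X} {c : ℝ} (hc : 0 < c)
    (h : ∃ᶠ n in atTop, ∃ J ⊆ F n,
      IsIndependent (translates G U V) Set.univ J ∧ c * (F n).card < J.card)
    {ε : ℝ} (hε : 0 < ε) :
    ∃ p ∈ epsAsymptoticPairs G X ε, (∃ u ∈ U, dist p.1 u ≤ ε) ∧ p.2 ∈ V := by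
  classical
  obtain ⟨δ, hδ, S, hS⟩ := hT ε hε
  obtain ⟨N, -, hNfin, hN⟩ := Metric.finite_approx_of_totallyBounded
    (isCompact_univ (X := X)).totallyBounded (δ / 2) (by positivity)
  have hball : ∀ x : X, ∃ y : hNfin.toFinset, dist x y < δ / 2 := by
    intro x
    obtain ⟨y, hy, hxy⟩ := Set.mem_iUnion₂.1 (hN (Set.mem_univ x))
    exact ⟨⟨y, hNfin.mem_toFinset.2 hy⟩, hxy⟩
  choose ρ hρ using hball
  set M := hNfin.toFinset.card
  -- For large `n` the boundary carries fewer than `2 ^ |J|` coarse itineraries.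
  have hsmall : ∀ᶠ n in atTop, (M : ℝ) * (crossing S (F n)).card ≤ c * (F n).card := by
    have := (hF.tendsto_crossing S).const_mul (M : ℝ)
    rw [mul_zero] at this
    filter_upwards [this.eventually_lt_const hc] with n hn
    have hpos : (0 : ℝ) < (F n).card := by exact_mod_cast (hF.nonempty n).card_pos
    rw [← mul_div_assoc, div_lt_iff₀ hpos] at hn
    exact hn.le
  obtain ⟨n, ⟨J, hJF, hJ, hJc⟩, hn⟩ := (h.and_eventually hsmall).exists
  have hlt : M * (crossing S (F n)).card < J.card := by exact_mod_cast hn.trans_lt hJc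
  have hpt : ∀ σ : J → Bool, ∃ x : X, ∀ g : J, x ∈ translates G U V (g : G) (σ g) := by
    intro σ
    obtain ⟨x, -, hx⟩ := hJ fun g => if h : g ∈ J then σ ⟨g, h⟩ else true
    exact ⟨x, fun g => by simpa using hx g g.2⟩
  choose x hx using hpt
  obtain ⟨σ, σ', hne, heq⟩ := Fintype.exists_ne_map_eq_of_card_lt
    (fun (σ : J → Bool) (g : crossing S (F n)) => ρ ((g : G) • x σ)) (by
      simp only [Fintype.card_fun, Fintype.card_coe, Fintype.card_bool]
      calc M ^ (crossing S (F n)).card ≤ (2 ^ M) ^ (crossing S (F n)).card :=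
            Nat.pow_le_pow_left Nat.lt_two_pow_self.le _
        _ = 2 ^ (M * (crossing S (F n)).card) := by rw [pow_mul]
        _ < 2 ^ J.card := Nat.pow_lt_pow_right one_lt_two hlt)
  obtain ⟨g₀, hg₀⟩ := Function.ne_iff.1 hne
  obtain ⟨a, b, ha, hb, hab⟩ : ∃ a b : X, (g₀ : G) • a ∈ U ∧ (g₀ : G) • b ∈ V ∧
      ∀ g ∈ crossing S (F n), dist (g • a) (g • b) < δ := by
    have hclose : ∀ g ∈ crossing S (F n), dist (g • x σ) (g • x σ') < δ := by
      intro g hg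
      have h1 := hρ (g • x σ)
      have h2 := hρ (g • x σ')
      rw [← show ρ (g • x σ) = ρ (g • x σ') from congrFun heq ⟨g, hg⟩] at h2
      linarith [dist_triangle_right (g • x σ) (g • x σ') (ρ (g • x σ) : X)]
    have h1 := hx σ g₀
    have h2 := hx σ' g₀
    simp only [translates, Set.mem_preimage] at h1 h2
    cases hs : σ g₀ <;> cases hs' : σ' g₀ <;> simp only [hs, hs', cond_true, cond_false] at h1 h2
    · exact absurd (hs.trans hs'.symm) hg₀
    · exact ⟨x σ', x σ, h2, h1, fun g hg => by rw [dist_comm]; exact hclose g hg⟩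
    · exact ⟨x σ, x σ', h1, h2, hclose⟩
    · exact absurd (hs.trans hs'.symm) hg₀
  obtain ⟨z, hz⟩ := hS (fun g => if g ∈ F n then g • a else g • b) (by
    intro s hs g
    have key : ¬ (g ∈ F n ↔ s * g ∈ F n) → dist ((s * g) • a) ((s * g) • b) < δ :=
      fun h => hab _ (mem_crossing hs h)
    by_cases h1 : g ∈ F n <;> by_cases h2 : s * g ∈ F n <;>
      simp only [h1, h2, if_true, if_false, smul_smul, dist_self, hδ]
    · exact key (by simp [h1, h2])
    · rw [dist_comm]
      exact key (by simp [h1, h2]))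
  refine ⟨((g₀ : G) • z, (g₀ : G) • b), ⟨(F n).image (· * (g₀ : G)⁻¹), fun g hg => ?_⟩,
    ⟨_, ha, ?_⟩, hb⟩
  · have hgF : g * g₀ ∉ F n := fun hmem =>
      hg (Finset.mem_image.2 ⟨_, hmem, by simp⟩)
    have := hz (g * g₀)
    simpa only [hgF, if_false, smul_smul] using this
  · have := hz g₀
    simpa only [hJF g₀.2, if_true] using this

end Tracing

/-! ### Empirical measures -/

section Empirical

variable {G X : Type*} [Group G] [MulAction G X] [MeasurableSpace X]

/-- The uniform measure on the orbit segment `g • z`, `g ∈ F`, counted with multiplicity. -/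
noncomputable def empirical (F : Finset G) (z : X) : Measure X :=
  ((F.card : ENNReal)⁻¹) • ∑ g ∈ F, Measure.dirac (g • z)

lemma isProbabilityMeasure_empirical {F : Finset G} (hF : F.Nonempty) (z : X) :
    IsProbabilityMeasure (empirical F z) := by
  constructor
  have h0 : (F.card : ENNReal) ≠ 0 := by simpa using hF.ne_empty
  simp [empirical, ENNReal.inv_mul_cancel h0]

lemma integral_empirical {F : Finset G} (z : X) [TopologicalSpace X] [BorelSpace X]
    (f : BoundedContinuousFunction X ℝ) :
    ∫ x, f x ∂(empirical F z) = (F.card : ℝ)⁻¹ * ∑ g ∈ F, f (g • z) := by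
  rw [empirical, integral_smul_measure, integral_finsetSum_measure]
  · have : ∀ g : G, ∫ x, f x ∂(Measure.dirac (g • z)) = f (g • z) := fun g =>
      integral_dirac' _ _ f.continuous.stronglyMeasurable
    simp [this]
  · exact fun g _ => f.integrable _

lemma le_empirical {F J : Finset G} (hF : F.Nonempty) (hJF : J ⊆ F) {z : X} {U : Set X}
    (hU : MeasurableSet U) (hJ : ∀ g ∈ J, g • z ∈ U) {c : ℝ} (hc : c * F.card ≤ J.card) :
    ENNReal.ofReal c ≤ empirical F z U := by
  have h0 : (F.card : ENNReal) ≠ 0 := by simpa using hF.ne_empty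
  have hsum : (J.card : ENNReal) ≤ ∑ g ∈ F, Measure.dirac (g • z) U := by
    calc (J.card : ENNReal) = ∑ g ∈ J, Measure.dirac (g • z) U := by
          rw [Finset.sum_congr rfl fun g hg => by
            rw [Measure.dirac_apply' _ hU, Set.indicator_of_mem (hJ g hg)]]
          simp
      _ ≤ _ := Finset.sum_le_sum_of_subset hJF
  simp only [empirical, Measure.smul_apply, Measure.finsetSum_apply, smul_eq_mul]
  calc ENNReal.ofReal c = (F.card : ENNReal)⁻¹ * (ENNReal.ofReal c * F.card) := by
        rw [mul_comm (ENNReal.ofReal c), ← mul_assoc,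
          ENNReal.inv_mul_cancel h0 (ENNReal.natCast_ne_top _), one_mul]
    _ ≤ (F.card : ENNReal)⁻¹ * J.card := by
        gcongr
        rw [← ENNReal.ofReal_natCast F.card, ← ENNReal.ofReal_natCast J.card,
          ← ENNReal.ofReal_mul' (Nat.cast_nonneg _)]
        exact ENNReal.ofReal_le_ofReal hc
    _ ≤ _ := by gcongr

open scoped Classical Pointwise symmDiff in
/-- Translating an orbit segment over `F` by `g` changes its averages by `|g F ∆ F| / |F|` at
most. -/
lemma abs_integral_smul_sub_le [TopologicalSpace X] [BorelSpace X] [ContinuousConstSMul G X]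
    (F : Finset G) (z : X) (g : G) (f : BoundedContinuousFunction X ℝ) :
    |∫ x, f (g • x) ∂(empirical F z) - ∫ x, f x ∂(empirical F z)| ≤
      ‖f‖ * ((({g} * F) ∆ F).card / (F.card : ℝ)) := by
  have h1 := integral_empirical (F := F) z (f.compContinuous ⟨_, continuous_const_smul g⟩)
  simp only [BoundedContinuousFunction.compContinuous_apply, ContinuousMap.coe_mk] at h1
  rw [h1, integral_empirical, ← mul_sub]
  have h2 : ∑ h ∈ F, f (g • h • z) = ∑ h ∈ {g} * F, f (h • z) := by
    rw [Finset.singleton_mul, Finset.smul_finset_def,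
      Finset.sum_image (MulAction.injective g).injOn]
    simp [mul_smul]
  have h3 : |∑ h ∈ {g} * F, f (h • z) - ∑ h ∈ F, f (h • z)| ≤ (({g} * F) ∆ F).card * ‖f‖ := by
    have hb : ∀ E : Finset G, |∑ h ∈ E, f (h • z)| ≤ E.card * ‖f‖ := by
      intro E
      have := norm_sum_le_of_le E fun h _ => f.norm_coe_le_norm (h • z)
      simpa using this
    rw [← Finset.sum_sdiff_sub_sum_sdiff]
    refine (abs_sub _ _).trans ((add_le_add (hb _) (hb _)).trans_eq ?_)
    rw [← add_mul, ← Nat.cast_add, symmDiff, Finset.sup_eq_union, Finset.card_union_of_disjoint]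
    exact disjoint_sdiff_sdiff
  rw [h2, abs_mul, abs_of_nonneg (by positivity)]
  calc _ ≤ (F.card : ℝ)⁻¹ * ((({g} * F) ∆ F).card * ‖f‖) := by gcongr
    _ = _ := by ring

end Empirical

/-! ### Invariant measures charging given sets -/

section InvariantMeasures

variable {G X : Type*} [Group G] [MulAction G X] [MeasurableSpace X]

/-- If orbit segments over infinitely many Følner sets spend a positive proportion of time in a
closed set, then some invariant measure charges it: a weak limit of empirical measures does. -/
theorem exists_invariant_measure_pos [MetricSpace X] [CompactSpace X] [BorelSpace X]
    [ContinuousConstSMul G X] {F : ℕ → Finset G} (hF : IsFolner F) {U : Set X} (hU : IsClosed U)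
    {c : ℝ} (hc : 0 < c)
    (h : ∃ᶠ n in atTop, ∃ J ⊆ F n, ∃ z : X, (∀ g ∈ J, g • z ∈ U) ∧ c * (F n).card ≤ J.card) :
    ∃ μ : Measure X, IsProbabilityMeasure μ ∧ SMulInvariantMeasure G X μ ∧ 0 < μ U := by
  classical
  obtain ⟨z₀⟩ : Nonempty X := by
    obtain ⟨n, J, -, z, -⟩ := h.exists
    exact ⟨z⟩
  have hz : ∀ n, ∃ z : X, (∃ J ⊆ F n, ∃ z : X, (∀ g ∈ J, g • z ∈ U) ∧ c * (F n).card ≤ J.card) →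
      ENNReal.ofReal c ≤ empirical (F n) z U := by
    intro n
    by_cases hn : ∃ J ⊆ F n, ∃ z : X, (∀ g ∈ J, g • z ∈ U) ∧ c * (F n).card ≤ J.card
    · obtain ⟨J, hJF, z, hzJ, hJc⟩ := hn
      exact ⟨z, fun _ => le_empirical (hF.nonempty n) hJF hU.measurableSet hzJ hJc⟩
    · exact ⟨z₀, fun h => absurd h hn⟩
  choose z hz using hz
  let ν : ℕ → ProbabilityMeasure X := fun n =>
    ⟨empirical (F n) (z n), isProbabilityMeasure_empirical (hF.nonempty n) _⟩
  have hfreq : ∃ᶠ n in atTop, ENNReal.ofReal c ≤ (ν n : Measure X) U := h.mono hz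
  let B : Filter ℕ := atTop ⊓ 𝓟 {n | ENNReal.ofReal c ≤ (ν n : Measure X) U}
  have hB : B.NeBot := frequently_mem_iff_neBot.1 hfreq
  let u : Ultrafilter ℕ := Ultrafilter.of B
  have huB : (u : Filter ℕ) ≤ B := Ultrafilter.of_le B
  have hutop : (u : Filter ℕ) ≤ atTop := huB.trans inf_le_left
  obtain ⟨μ, -, hμ⟩ := isCompact_univ.ultrafilter_le_nhds (u.map ν) (by simp)
  have hlim : Tendsto ν u (𝓝 μ) := hμ
  refine ⟨μ, inferInstance, ?_, ?_⟩
  · refine ⟨fun g s hs => ?_⟩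
    have hg : Measurable fun x : X => g • x := (continuous_const_smul g).measurable
    rw [← Measure.map_apply hg hs]
    have : IsFiniteMeasure ((μ : Measure X).map fun x => g • x) := by infer_instance
    congr 1
    refine ext_of_forall_integral_eq_of_IsFiniteMeasure fun f => ?_
    rw [integral_map hg.aemeasurable f.continuous.aestronglyMeasurable]
    have hint := ProbabilityMeasure.tendsto_iff_forall_integral_tendsto.1 hlim
    have hdiff := (hint (f.compContinuous ⟨_, continuous_const_smul g⟩)).sub (hint f)
    have hzero := (((hF.tendsto {g} (Finset.singleton_nonempty g)).const_mul ‖f‖).mono_left hutop)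
    rw [mul_zero] at hzero
    refine sub_eq_zero.1 (tendsto_nhds_unique hdiff (squeeze_zero_norm (fun n => ?_) hzero))
    exact abs_integral_smul_sub_le (F n) (z n) g f
  · have hle := ProbabilityMeasure.limsup_measure_closed_le_of_tendsto hlim hU
    refine lt_of_lt_of_le (ENNReal.ofReal_pos.2 hc) (le_trans ?_ hle)
    have hev : ∀ᶠ n in (u : Filter ℕ), ENNReal.ofReal c ≤ (ν n : Measure X) U :=
      huB (mem_inf_of_right (mem_principal_self _))
    exact le_limsup_of_frequently_le hev.frequently (by isBoundedDefault)

/-- Countably many sets, each charged by some invariant probability measure, are charged by a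
common one. -/
lemma exists_invariant_measure_forall_pos {ι : Type*} [Countable ι] [Nonempty ι]
    [MeasurableConstSMul G X] (A : ι → Set X)
    (h : ∀ i, ∃ μ : Measure X, IsProbabilityMeasure μ ∧ SMulInvariantMeasure G X μ ∧ 0 < μ (A i)) :
    ∃ μ : Measure X, IsProbabilityMeasure μ ∧ SMulInvariantMeasure G X μ ∧ ∀ i, 0 < μ (A i) := by
  choose ν h1 h2 h3 using h
  obtain ⟨e, he⟩ := exists_surjective_nat ι
  refine ⟨Measure.sum fun n : ℕ => (2⁻¹ : ENNReal) ^ (n + 1) • ν (e n), ⟨?_⟩, ⟨?_⟩, fun i => ?_⟩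
  · rw [Measure.sum_apply _ MeasurableSet.univ]
    simp [ENNReal.tsum_geometric_add_one, ENNReal.inv_mul_cancel]
  · intro g s hs
    rw [Measure.sum_apply _ (measurable_const_smul g hs), Measure.sum_apply _ hs]
    simp
  · obtain ⟨n, rfl⟩ := he i
    refine lt_of_lt_of_le ?_ (Measure.le_iff'.1 (Measure.le_sum _ n) _)
    rw [Measure.smul_apply, smul_eq_mul]
    exact ENNReal.mul_pos (by simp) (h3 _).ne'

end InvariantMeasures

/-! ### Separated return times -/

section Recurrence

variable {G : Type*} [Group G]

/-- Every finite `J` has a subset of proportional size whose translates `L * c` are pairwise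
disjoint: a maximal one works. -/
lemma exists_separated_subset {L : Finset G} (hL : L.Nonempty) (J : Finset G) :
    ∃ J' ⊆ J, (∀ c ∈ J', ∀ c' ∈ J', ∀ l ∈ L, ∀ l' ∈ L, l * c = l' * c' → c = c') ∧
      J.card ≤ L.card ^ 2 * J'.card := by
  classical
  let P : Finset (Finset G) := J.powerset.filter fun J' =>
    ∀ c ∈ J', ∀ c' ∈ J', ∀ l ∈ L, ∀ l' ∈ L, l * c = l' * c' → c = c'
  have hP : ∅ ∈ P := by simp [P]
  obtain ⟨J', hJ'P, hmax⟩ := P.exists_max_image Finset.card ⟨∅, hP⟩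
  obtain ⟨hJ'J, hsep⟩ := Finset.mem_filter.1 hJ'P
  rw [Finset.mem_powerset] at hJ'J
  refine ⟨J', hJ'J, hsep, ?_⟩
  have hcover : ∀ g ∈ J, ∃ c ∈ J', ∃ l ∈ L, ∃ l' ∈ L, l * g = l' * c := by
    intro g hg
    by_cases hgJ' : g ∈ J'
    · obtain ⟨l, hl⟩ := hL
      exact ⟨g, hgJ', l, hl, l, hl, rfl⟩
    · by_contra! hcon
      have hins : insert g J' ∈ P := by
        refine Finset.mem_filter.2 ⟨Finset.mem_powerset.2 (Finset.insert_subset hg hJ'J), ?_⟩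
        intro c hc c' hc' l hl l' hl' h
        rcases Finset.mem_insert.1 hc with hcg | hcJ <;>
          rcases Finset.mem_insert.1 hc' with hcg' | hcJ'
        · rw [hcg, hcg']
        · exact absurd (hcg ▸ h) (hcon c' hcJ' l hl l' hl')
        · exact absurd (hcg' ▸ h.symm) (hcon c hcJ l' hl' l hl)
        · exact hsep c hcJ c' hcJ' l hl l' hl' h
      have := hmax _ hins
      rw [Finset.card_insert_of_notMem hgJ'] at this
      omega
  have hsub : J ⊆ ((L ×ˢ L) ×ˢ J').image fun p => p.1.1⁻¹ * (p.1.2 * p.2) := by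
    intro g hg
    obtain ⟨c, hc, l, hl, l', hl', h⟩ := hcover g hg
    exact Finset.mem_image.2 ⟨((l, l'), c), by simp [hl, hl', hc], by simp [← h]⟩
  calc J.card ≤ _ := Finset.card_le_card hsub
    _ ≤ _ := Finset.card_image_le
    _ = _ := by rw [Finset.card_product, Finset.card_product, sq]

/-- For an invariant measure some orbit segment over `F` spends at least the proportion `μ B` of
time in `B`, since this is the average proportion. -/
lemma exists_orbit_density {X : Type*} [MulAction G X] [MeasurableSpace X]
    [MeasurableConstSMul G X] (μ : Measure X) [IsProbabilityMeasure μ] [SMulInvariantMeasure G X μ]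
    {B : Set X} (hB : MeasurableSet B) (F : Finset G) :
    ∃ z : X, ∃ J ⊆ F, (∀ g ∈ J, g • z ∈ B) ∧ μ.real B * F.card ≤ J.card := by
  classical
  have hmeas : ∀ g : G, MeasurableSet ((fun x : X => g • x) ⁻¹' B) := fun g =>
    measurable_const_smul g hB
  let f : X → ENNReal := fun x => ∑ g ∈ F, ((fun x : X => g • x) ⁻¹' B).indicator 1 x
  have hf : Measurable f :=
    Finset.measurable_fun_sum _ fun g _ => measurable_one.indicator (hmeas g)
  have hint : ∫⁻ x, f x ∂μ = F.card * μ B := by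
    rw [lintegral_finsetSum _ fun g _ => measurable_one.indicator (hmeas g)]
    simp [lintegral_indicator_one (hmeas _),
      SMulInvariantMeasure.measure_preimage_smul _ hB]
  obtain ⟨z, hz⟩ := exists_lintegral_le (μ := μ) (f := f) (by
    rw [hint]
    exact ENNReal.mul_ne_top (ENNReal.natCast_ne_top _) (measure_ne_top _ _))
  refine ⟨z, F.filter fun g => g • z ∈ B, Finset.filter_subset _ _,
    fun g hg => (Finset.mem_filter.1 hg).2, ?_⟩
  have hfz : f z = ((F.filter fun g => g • z ∈ B).card : ENNReal) := by
    simp [f, Set.indicator_apply, Finset.sum_boole]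
  rw [hint, hfz] at hz
  have := ENNReal.toReal_mono (ENNReal.natCast_ne_top _) hz
  rw [ENNReal.toReal_mul, ENNReal.toReal_natCast, ENNReal.toReal_natCast] at this
  rwa [mul_comm]

end Recurrence

/-! ### Independence from asymptotic pairs -/

section Swapping

variable {G X : Type*} [Group G] [MetricSpace X] [MulAction G X]

/-- Let `(x, y)` be asymptotic. In an orbit returning near `x` at the times of a sufficiently
separated set `J`, any choice of these passages can be replaced by passages of `y`: since the
orbits of `x` and `y` are close outside a finite set, the result is a pseudo-orbit, and tracing it
shows that `J` is an independence set. -/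
theorem exists_isIndependent_of_asymptotic [ContinuousConstSMul G X] (hT : HasPOTP G X) {x y : X}
    (hxy : (x, y) ∈ asymptoticPairs G X) {U V : Set X} (hU : U ∈ 𝓝 x) (hV : V ∈ 𝓝 y) :
    ∃ L : Finset G, L.Nonempty ∧ ∃ B ∈ 𝓝 x, ∀ (z : X) (J : Finset G), (∀ c ∈ J, c • z ∈ B) →
      (∀ c ∈ J, ∀ c' ∈ J, ∀ l ∈ L, ∀ l' ∈ L, l * c = l' * c' → c = c') →
      IsIndependent (translates G U V) Set.univ J := by
  classical
  obtain ⟨r₁, hr₁, hrU⟩ := Metric.nhds_basis_closedBall.mem_iff.1 hU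
  obtain ⟨r₂, hr₂, hrV⟩ := Metric.nhds_basis_closedBall.mem_iff.1 hV
  set ε := min (r₁ / 2) r₂
  have hε : 0 < ε := by positivity
  obtain ⟨δ, hδ, S, hS⟩ := hT ε hε
  obtain ⟨K, hK⟩ := hxy (δ / 2) (by positivity)
  -- The passage of `y` replaces the orbit on `P * c`. Crossing the boundary of `P`, in either
  -- direction, involves comparing `x` and `y` outside `K` only.
  set P : Finset G := insert 1 (K ∪ (S ×ˢ K).image fun p => p.1⁻¹ * p.2)
  set L : Finset G := P ∪ (S ×ˢ P).image fun p => p.1 * p.2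
  have hKP : ∀ k ∈ K, k ∈ P := fun k hk =>
    Finset.mem_insert_of_mem (Finset.mem_union_left _ hk)
  have hSKP : ∀ s ∈ S, ∀ k ∈ K, s⁻¹ * k ∈ P := fun s hs k hk =>
    Finset.mem_insert_of_mem (Finset.mem_union_right _
      (Finset.mem_image.2 ⟨(s, k), by simp [hs, hk], rfl⟩))
  have hPL : ∀ k ∈ P, k ∈ L := fun k hk => Finset.mem_union_left _ hk
  have hSPL : ∀ s ∈ S, ∀ k ∈ P, s * k ∈ L := fun s hs k hk =>
    Finset.mem_union_right _ (Finset.mem_image.2 ⟨(s, k), by simp [hs, hk], rfl⟩)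
  have hP1 : 1 ∈ P := Finset.mem_insert_self _ _
  have hBnhds : Metric.closedBall x ε ∩ {w | ∀ l ∈ L, dist (l • w) (l • x) < δ / 2} ∈ 𝓝 x := by
    refine inter_mem (Metric.closedBall_mem_nhds x hε) ?_
    refine (Finset.eventually_all L).2 fun l _ => ?_
    exact (continuous_const_smul l).continuousAt.eventually (Metric.ball_mem_nhds _ (by positivity))
  refine ⟨L, ⟨1, hPL 1 hP1⟩, _, hBnhds, fun z J hz hsep σ => ?_⟩
  have hclose : ∀ c ∈ J, ∀ l ∈ L, l ∉ K → dist ((l * c) • z) (l • y) < δ := by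
    intro c hc l hl hlK
    have h1 := (hz c hc).2 l hl
    have h2 : dist (l • x) (l • y) ≤ δ / 2 := hK l hlK
    rw [smul_smul] at h1
    linarith [dist_triangle ((l * c) • z) (l • x) (l • y)]
  let Q : G → G → Prop := fun g c => c ∈ J ∧ σ c = false ∧ g * c⁻¹ ∈ P
  have huniq : ∀ {l c g c'}, c ∈ J → l ∈ L → g = l * c → Q g c' → c' = c := by
    intro l c g c' hc hl hg hQ
    refine hsep c' hQ.1 c hc _ (hPL _ hQ.2.2) l hl ?_
    rw [← hg]
    group
  let w : G → X := fun g => if h : ∃ c, Q g c then (g * h.choose⁻¹) • y else g • z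
  have hw : ∀ {g c}, Q g c → w g = (g * c⁻¹) • y := by
    intro g c hQ
    have h : ∃ c, Q g c := ⟨c, hQ⟩
    have hc : h.choose = c := huniq hQ.1 (hPL _ hQ.2.2) (by group) h.choose_spec
    simp only [w, dif_pos h, hc]
  have hw' : ∀ {g}, (¬ ∃ c, Q g c) → w g = g • z := fun h => by simp only [w, dif_neg h]
  obtain ⟨p, hp⟩ := hS w (by
    intro s hs g
    by_cases h1 : ∃ c, Q g c
    · obtain ⟨c, hc⟩ := h1
      rw [hw hc, smul_smul]
      have hsL := hSPL s hs _ hc.2.2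
      by_cases h2 : ∃ c', Q (s * g) c'
      · obtain ⟨c', hc'⟩ := h2
        have hcc : c' = c := huniq hc.1 hsL (by group) hc'
        subst hcc
        rw [hw hc', mul_assoc, dist_self]
        exact hδ
      · rw [hw' h2, dist_comm]
        have hK' : s * (g * c⁻¹) ∉ K := fun h =>
          h2 ⟨c, hc.1, hc.2.1, by rw [mul_assoc]; exact hKP _ h⟩
        have := hclose c hc.1 _ hsL hK'
        rwa [show s * (g * c⁻¹) * c = s * g by group] at this
    · rw [hw' h1, smul_smul]
      by_cases h2 : ∃ c', Q (s * g) c'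
      · obtain ⟨c, hc⟩ := h2
        rw [hw hc]
        have hK' : s * g * c⁻¹ ∉ K := fun h =>
          h1 ⟨c, hc.1, hc.2.1, by
            have := hSKP s hs _ h
            rwa [show s⁻¹ * (s * g * c⁻¹) = g * c⁻¹ by group] at this⟩
        have := hclose c hc.1 _ (hPL _ hc.2.2) hK'
        rwa [show s * g * c⁻¹ * c = s * g by group] at this
      · rw [hw' h2, dist_self]
        exact hδ)
  refine ⟨p, trivial, fun c hc => ?_⟩
  have hpc := hp c
  simp only [translates, Set.mem_preimage]
  rcases hσ : σ c with _ | _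
  · have hQ : Q c c := ⟨hc, hσ, by simpa using hP1⟩
    rw [hw hQ, mul_inv_cancel, one_smul] at hpc
    exact hrV (hpc.trans (min_le_right _ _))
  · have hQ : ¬ ∃ c', Q c c' := by
      rintro ⟨c', hc'⟩
      have : c' = c := huniq hc (hPL 1 hP1) (by simp) hc'
      rw [← this, hc'.2.1] at hσ
      exact Bool.false_ne_true hσ
    rw [hw' hQ] at hpc
    refine hrU ?_
    have h1 : dist (c • z) x ≤ ε := (hz c hc).1
    have h2 : ε ≤ r₁ / 2 := min_le_left _ _
    rw [Metric.mem_closedBall]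
    linarith [dist_triangle (c • p) (c • z) x]

/-- If the sets `J ⊆ F n` are independent of uniformly positive density, the entropy of
`{Uᶜ, Vᶜ}` is positive. -/
lemma coverEntropy_pos {G X : Type*} [Group G] [MulAction G X] {F : ℕ → Finset G}
    (hF : ∀ n, (F n).Nonempty) {U V : Set X} (hUV : Disjoint U V) {c : ℝ} (hc : 0 < c)
    (h : ∀ n, ∃ J ⊆ F n, IsIndependent (translates G U V) Set.univ J ∧
      c * (F n).card ≤ J.card) : 0 < coverEntropy F {Uᶜ, Vᶜ} := by
  have hpos : (0 : EReal) < ((c * Real.log 2 : ℝ) : EReal) := by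
    have := mul_pos hc (Real.log_pos one_lt_two)
    exact_mod_cast this
  refine hpos.trans_le (le_limsup_of_frequently_le (Frequently.of_forall fun n => ?_)
    (by isBoundedDefault))
  obtain ⟨J, hJF, hJ, hJc⟩ := h n
  have hn : (0 : ℝ) < (F n).card := by exact_mod_cast (hF n).card_pos
  rw [EReal.coe_le_coe_iff, le_div_iff₀ hn]
  have hN : ((2 : ℝ) ^ J.card) ≤ minSubcover (refineCover {Uᶜ, Vᶜ} (F n)) := by
    exact_mod_cast two_pow_le_minSubcover hUV hJF hJ
  calc c * Real.log 2 * (F n).card = c * (F n).card * Real.log 2 := by ring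
    _ ≤ J.card * Real.log 2 := by
        gcongr
    _ = Real.log (2 ^ J.card) := by rw [Real.log_pow]
    _ ≤ _ := Real.log_le_log (by positivity) hN

end Swapping

end GTDS

/-! ### Entropy pairs and asymptotic pairs -/

theorem theorem4p2 {G X : Type*} [Group G] [Countable G]
    [MetricSpace X] [CompactSpace X] [MeasurableSpace X] [BorelSpace X]
    [MulAction G X] [ContinuousConstSMul G X]
    (F : ℕ → Finset G) (hF : GTDS.IsFolner F) (hT : GTDS.HasPOTP G X) :
    (∀ x y : X, (x, y) ∈ GTDS.entropyPairs F →
      (∀ ε : ℝ, 0 < ε → (x, y) ∈ closure (GTDS.epsAsymptoticPairs G X ε) \ Set.diagonal X) ∧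
      GTDS.InCommonSupport G x y) ∧
    (∀ x y : X, (x, y) ∈ GTDS.asymptoticPairs G X → GTDS.InCommonSupport G x y →
      (x, y) ∈ GTDS.entropyPairs F ∪ Set.diagonal X) := by
  open GTDS Filter Topology MeasureTheory in
  have hmeas : MeasurableConstSMul G X :=
    ⟨fun g => (continuous_const_smul g).measurable⟩
  refine ⟨fun x y hxy => ?_, fun x y hxy ⟨μ, hμ, hinv, hx, hy⟩ => ?_⟩
  · obtain ⟨hne, hpair⟩ := hxy
    have hdist : 0 < dist x y := dist_pos.2 hne
    -- Balls of radius less than `dist x y / 2` around `x` and `y` are disjoint.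
    have hindep : ∀ r : ℝ, 0 < r → ∃ r' : ℝ, 0 < r' ∧ r' ≤ r ∧ ∃ c : ℝ, 0 < c ∧
        ∃ᶠ n in atTop, ∃ J ⊆ F n, IsIndependent
          (translates G (Metric.closedBall x r') (Metric.closedBall y r')) Set.univ J ∧
          c * (F n).card < J.card := by
      intro r hr
      have hr' : 0 < min r (dist x y / 3) := by positivity
      have hdisj : Disjoint (Metric.closedBall x (min r (dist x y / 3)))
          (Metric.closedBall y (min r (dist x y / 3))) := by
        apply Metric.closedBall_disjoint_closedBall
        linarith [min_le_right r (dist x y / 3)]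
      exact ⟨_, hr', min_le_left _ _, exists_independence_density hdisj hF.nonempty
        (hpair _ _ Metric.isClosed_closedBall Metric.isClosed_closedBall
          (Metric.closedBall_mem_nhds _ hr') (Metric.closedBall_mem_nhds _ hr') hdisj)⟩
    refine ⟨fun ε hε => ⟨?_, hne⟩, ?_⟩
    · rw [Metric.mem_closure_iff]
      intro r hr
      obtain ⟨r', -, hr'r, c, hc, h⟩ := hindep (r / 4) (by positivity)
      obtain ⟨p, ⟨E, hE⟩, ⟨u, hu, hpu⟩, hpV⟩ :=
        exists_mem_epsAsymptoticPairs hF hT hc h (ε := min ε (r / 4)) (by positivity)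
      refine ⟨p, ⟨E, fun g hg => (hE g hg).trans (min_le_left _ _)⟩, ?_⟩
      rw [Prod.dist_eq, max_lt_iff]
      rw [Metric.mem_closedBall] at hu hpV
      have := min_le_right ε (r / 4)
      constructor
      · rw [dist_comm]
        linarith [dist_triangle p.1 u x]
      · rw [dist_comm]
        linarith
    · have hex : ∀ i : ℕ × Bool, ∃ μ : Measure X, IsProbabilityMeasure μ ∧
          SMulInvariantMeasure G X μ ∧
          0 < μ (Metric.closedBall (bif i.2 then x else y) (1 / ((i.1 : ℝ) + 1))) := by
        rintro ⟨k, b⟩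
        obtain ⟨r', -, hr', c, hc, h⟩ := hindep (1 / ((k : ℝ) + 1)) (by positivity)
        refine exists_invariant_measure_pos hF Metric.isClosed_closedBall hc
          (h.mono fun n ⟨J, hJF, hJ, hJc⟩ => ?_)
        obtain ⟨z, -, hz⟩ := hJ fun _ => b
        refine ⟨J, hJF, z, fun g hg => Metric.closedBall_subset_closedBall hr' ?_, hJc.le⟩
        have := hz g hg
        cases b <;> exact this
      obtain ⟨μ, hμ, hinv, hpos⟩ := exists_invariant_measure_forall_pos _ hex
      have hsupp : ∀ b : Bool, (bif b then x else y) ∈ μ.support := by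
        intro b
        rw [Measure.mem_support_iff_forall]
        intro W hW
        obtain ⟨r, hr, hrW⟩ := Metric.nhds_basis_closedBall.mem_iff.1 hW
        obtain ⟨k, hk⟩ := exists_nat_one_div_lt hr
        exact (hpos (k, b)).trans_le
          (measure_mono ((Metric.closedBall_subset_closedBall hk.le).trans hrW))
      exact ⟨μ, hμ, hinv, hsupp true, hsupp false⟩
  · by_cases hne : x = y
    · exact Or.inr hne
    refine Or.inl ⟨hne, fun U V _ _ hU hV hUV => ?_⟩
    obtain ⟨L, hL, B, hB, hind⟩ := exists_isIndependent_of_asymptotic hT hxy hU hV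
    obtain ⟨B', hB'B, hB'o, hxB'⟩ := mem_nhds_iff.1 hB
    have hμB : 0 < μ.real B' := by
      rw [Measure.real, ENNReal.toReal_pos_iff]
      exact ⟨Measure.mem_support_iff_forall x |>.1 hx _ (hB'o.mem_nhds hxB'),
        measure_lt_top _ _⟩
    have hLc : (0 : ℝ) < (L.card : ℝ) ^ 2 := by
      have : (0 : ℝ) < L.card := by exact_mod_cast hL.card_pos
      positivity
    refine coverEntropy_pos hF.nonempty hUV (c := μ.real B' / (L.card : ℝ) ^ 2) (by positivity)
      fun n => ?_
    obtain ⟨z, J, hJF, hzJ, hJc⟩ := exists_orbit_density (G := G) μ hB'o.measurableSet (F n)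
    obtain ⟨J', hJ'J, hsep, hJ'c⟩ := exists_separated_subset hL J
    refine ⟨J', hJ'J.trans hJF, hind z J' (fun c hc => hB'B (hzJ c (hJ'J hc))) hsep, ?_⟩
    rw [div_mul_eq_mul_div, div_le_iff₀ hLc, mul_comm (J'.card : ℝ)]
    exact hJc.trans (by exact_mod_cast hJ'c)
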